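/- For $\lambda\in(0,\tfrac12)$ and $x\in\mathbb{R}$ let $$\varphi_\lambda(x)=\int_0^{\infty}y^{-2\lambda}e^{-(y-x)^2/2}\,dy.$$ For every $\lambda\in(0,\tfrac12)$ there are a unique $x_1^\lambda<0$ with $\varphi_\lambda''(x_1^\lambda)=0$ and a unique $z^\lambda>0$ with $\varphi_\lambda''(z^\lambda)+\varphi_\lambda''(-z^\lambda)=0$; put $\sigma_\lambda=-x_1^\lambda/z^\lambda$. For every $\sigma\in(0,1)$ there is a unique $\lambda_\sigma\in(0,\tfrac12)$ with $\sigma_{\lambda_\sigma}=\sigma$. The function $\sigma\mapsto\lambda_\sigma$ is strictly increasing on $(0,1)$, and $$\lim_{\sigma\to0^+}\lambda_\sigma=0,\qquad \lim_{\sigma\to1^-}\lambda_\sigma=\tfrac12 .$$ -/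

import Mathlib

open Set Filter Topology MeasureTheory

/-- `φ_l(x) = ∫₀^∞ y^(-2l) exp(-(y-x)²/2) dy`, a convergent integral for `l < 1/2`. -/
noncomputable def phi (l x : ℝ) : ℝ :=
  ∫ y in Ioi (0 : ℝ), y ^ (-2 * l) * Real.exp (-(y - x) ^ 2 / 2)

/-- The second derivative `φ_l''` in the space variable. -/
noncomputable def phi'' (l x : ℝ) : ℝ := deriv (deriv (phi l)) x

/-- `x` is a negative zero of `φ_l''`. -/
def IsNegInflection (l x : ℝ) : Prop := x < 0 ∧ phi'' l x = 0

/-- `z` is a positive zero of the second derivative of the even function `φ_l(x) + φ_l(-x)`. -/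
def IsEvenInflection (l z : ℝ) : Prop := 0 < z ∧ phi'' l z + phi'' l (-z) = 0

/-- The constant `x₁^l < 0` with `φ_l''(x₁^l) = 0`. -/
noncomputable def xOne (l : ℝ) : ℝ := Classical.epsilon (IsNegInflection l)

/-- The constant `z^l > 0` with `φ_l''(z^l) + φ_l''(-z^l) = 0`. -/
noncomputable def zConst (l : ℝ) : ℝ := Classical.epsilon (IsEvenInflection l)

/-- `σ_l = -x₁^l / z^l`, for `l ∈ (0, 1/2)`. -/
noncomputable def sigmaOf (l : ℝ) : ℝ := -xOne l / zConst l

/-- `l ∈ (0, 1/2)` satisfies `σ_l = s`. -/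
def IsLambda (s l : ℝ) : Prop := l ∈ Ioo (0 : ℝ) (1 / 2) ∧ sigmaOf l = s

/-- The constant `λ_s ∈ (0, 1/2)` with `σ_{λ_s} = s`, for `s ∈ (0, 1)`. -/
noncomputable def lambdaOf (s : ℝ) : ℝ := Classical.epsilon (IsLambda s)

/-! Write `M_s(x)` for `gaussMoment s x`. Then `φ_l(x) = exp(-x²/2) M_{-2l}(x)`, `M_s' = M_{s+1}`
and `M_{s+2} = x M_{s+1} + (s+1) M_s`, so every sign question about `φ_l''` concerns moments.

Negative zero: put `t = -x` and `s = -2l`. Divided by `M_s(-t)`, the curvature equals both `t² + 1 -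
4l - M_{s+2}/M_s` and `t² - 2l + t M_{s+1}/M_s`. Chebyshev's inequality makes `M_{s+2}/M_s` monotone
in `x` and `M_{s+1}/M_s` monotone in `s`. The first form then gives uniqueness of the root, the
second its strict growth in `l` (`neg_xOne_lt`).

Even part: its normalised curvature `v` is strictly decreasing on `[0, ∞)` and solves a Hermite
equation with parameter `1 + 2l`. Sturm comparison shows that `z^l` does not increase with `l`
(`zConst_le`).

Hence `σ_l` is continuous and strictly increasing. The bounds `4l - 1 < x₁² < 2l < z² ≤ 2/(1 + 2l)`
place it in `(0, 1)` and, with the monotonicity of `z^l`, give its limits `0` and `1`; `λ` is its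
inverse. -/

/-! ### Exponential moments: derivative, recurrence, continuity in the exponent. -/

/-- The integrand of the exponential moments `gaussMoment`. -/
noncomputable def gaussWeight (s x y : ℝ) : ℝ := y ^ s * Real.exp (x * y - y ^ 2 / 2)

/-- The moment `∫₀^∞ y^s exp(xy - y²/2) dy`, convergent for `s > -1`. -/
noncomputable def gaussMoment (s x : ℝ) : ℝ := ∫ y in Ioi (0 : ℝ), gaussWeight s x y

theorem gaussWeight_pos (s x : ℝ) {y : ℝ} (hy : 0 < y) : 0 < gaussWeight s x y :=
  mul_pos (Real.rpow_pos_of_pos hy s) (Real.exp_pos _)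

theorem measurable_gaussWeight (s x : ℝ) : Measurable (gaussWeight s x) := by
  unfold gaussWeight
  fun_prop

theorem integrableOn_gaussWeight {s : ℝ} (hs : -1 < s) (x : ℝ) :
    IntegrableOn (gaussWeight s x) (Ioi 0) := by
  have h := (integrableOn_rpow_mul_exp_neg_mul_sq (b := 1 / 4) (by norm_num) hs).const_mul
    (Real.exp (x ^ 2))
  refine Integrable.mono' h (measurable_gaussWeight s x).aestronglyMeasurable ?_
  refine (ae_restrict_iff' measurableSet_Ioi).2 (Eventually.of_forall fun y hy => ?_)
  rw [Real.norm_of_nonneg (gaussWeight_pos s x hy).le, gaussWeight]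
  have h1 : Real.exp (x * y - y ^ 2 / 2) ≤ Real.exp (x ^ 2) * Real.exp (-(1 / 4) * y ^ 2) := by
    rw [← Real.exp_add]
    exact Real.exp_le_exp.2 (by nlinarith [sq_nonneg (x - y / 2)])
  calc y ^ s * Real.exp (x * y - y ^ 2 / 2)
      ≤ y ^ s * (Real.exp (x ^ 2) * Real.exp (-(1 / 4) * y ^ 2)) :=
        mul_le_mul_of_nonneg_left h1 (Real.rpow_nonneg (le_of_lt hy) s)
    _ = _ := by ring

theorem gaussMoment_pos {s : ℝ} (hs : -1 < s) (x : ℝ) : 0 < gaussMoment s x := by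
  unfold gaussMoment
  rw [setIntegral_pos_iff_support_of_nonneg_ae _ (integrableOn_gaussWeight hs x)]
  · have : Function.support (gaussWeight s x) ∩ Ioi 0 = Ioi 0 :=
      inter_eq_right.2 fun y hy => (gaussWeight_pos s x hy).ne'
    rw [this]
    simp
  · exact (ae_restrict_iff' measurableSet_Ioi).2
      (Eventually.of_forall fun y hy => (gaussWeight_pos s x hy).le)

theorem hasDerivAt_gaussMoment {s : ℝ} (hs : -1 < s) (x : ℝ) :
    HasDerivAt (gaussMoment s) (gaussMoment (s + 1) x) x := by
  refine (hasDerivAt_integral_of_dominated_loc_of_deriv_le (μ := volume.restrict (Ioi (0 : ℝ)))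
    (F := gaussWeight s) (F' := gaussWeight (s + 1)) (s := Metric.ball x 1)
    (bound := gaussWeight (s + 1) (x + 1)) (Metric.ball_mem_nhds x one_pos)
    (Eventually.of_forall fun t => (measurable_gaussWeight s t).aestronglyMeasurable)
    (integrableOn_gaussWeight hs x) (measurable_gaussWeight _ x).aestronglyMeasurable
    ?_ (integrableOn_gaussWeight (by linarith) _) ?_).2
  · refine (ae_restrict_iff' measurableSet_Ioi).2 (Eventually.of_forall fun y hy t ht => ?_)
    rw [Real.norm_of_nonneg (gaussWeight_pos _ t hy).le]
    have hy : 0 < y := hy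
    rw [Metric.mem_ball, Real.dist_eq, abs_lt] at ht
    refine mul_le_mul_of_nonneg_left (Real.exp_le_exp.2 ?_) (Real.rpow_nonneg hy.le _)
    nlinarith
  · refine (ae_restrict_iff' measurableSet_Ioi).2 (Eventually.of_forall fun y hy t _ => ?_)
    have hy : 0 < y := hy
    have h1 : HasDerivAt (fun t : ℝ => t * y - y ^ 2 / 2) y t := by
      simpa using ((hasDerivAt_id t).mul_const y).sub_const (y ^ 2 / 2)
    have h2 := (h1.exp).const_mul (y ^ s)
    refine h2.congr_deriv ?_
    rw [gaussWeight, Real.rpow_add_one hy.ne']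
    ring

theorem continuous_gaussMoment {s : ℝ} (hs : -1 < s) : Continuous (gaussMoment s) :=
  continuous_iff_continuousAt.2 fun x => (hasDerivAt_gaussMoment hs x).continuousAt

theorem strictMono_gaussMoment {s : ℝ} (hs : -1 < s) : StrictMono (gaussMoment s) :=
  strictMono_of_deriv_pos fun x => by
    rw [(hasDerivAt_gaussMoment hs x).deriv]
    exact gaussMoment_pos (by linarith) x

theorem hasDerivAt_gaussWeight (s x : ℝ) {y : ℝ} (hy : 0 < y) :
    HasDerivAt (gaussWeight (s + 1) x)
      ((s + 1) * gaussWeight s x y + x * gaussWeight (s + 1) x y - gaussWeight (s + 2) x y) y := by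
  have h1 : HasDerivAt (fun y : ℝ => x * y - y ^ 2 / 2) (x - y) y := by
    have h := ((hasDerivAt_id y).const_mul x).sub (((hasDerivAt_id y).pow 2).div_const 2)
    refine h.congr_deriv ?_
    simp
  have h2 := (Real.hasDerivAt_rpow_const (p := s + 1) (Or.inl hy.ne')).mul h1.exp
  refine h2.congr_deriv ?_
  have e1 : y ^ (s + 1 - 1) = y ^ s := by ring_nf
  have e2 : y ^ (s + 2) = y ^ (s + 1) * y := by
    rw [← Real.rpow_add_one hy.ne']
    ring_nf
  simp only [gaussWeight, e1, e2]
  ring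

/-- Integrate the derivative of `y^(s+1) exp(xy - y²/2)` over the half-line; both boundary terms
vanish, the one at `0` because `s + 1 > 0`. -/
theorem gaussMoment_add_two {s : ℝ} (hs : -1 < s) (x : ℝ) :
    gaussMoment (s + 2) x = x * gaussMoment (s + 1) x + (s + 1) * gaussMoment s x := by
  have i0 := integrableOn_gaussWeight hs x
  have i1 := integrableOn_gaussWeight (s := s + 1) (by linarith) x
  have i2 := integrableOn_gaussWeight (s := s + 2) (by linarith) x
  have i01 : IntegrableOn (fun y => (s + 1) * gaussWeight s x y + x * gaussWeight (s + 1) x y)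
      (Ioi 0) := (i0.const_mul (s + 1)).add (i1.const_mul x)
  have hd := fun y (hy : y ∈ Ioi (0 : ℝ)) => hasDerivAt_gaussWeight s x hy
  have hc : Continuous (gaussWeight (s + 1) x) := by
    unfold gaussWeight
    exact (Real.continuous_rpow_const (by linarith)).mul (by fun_prop)
  have h := integral_Ioi_of_hasDerivAt_of_tendsto hc.continuousWithinAt hd (i01.sub i2)
    (tendsto_zero_of_hasDerivAt_of_integrableOn_Ioi hd (i01.sub i2) i1)
  have h0 : gaussWeight (s + 1) x 0 = 0 := by
    simp [gaussWeight, Real.zero_rpow (show s + 1 ≠ 0 by linarith)]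
  have e : ∫ y in Ioi (0 : ℝ), ((s + 1) * gaussWeight s x y + x * gaussWeight (s + 1) x y
      - gaussWeight (s + 2) x y)
      = (s + 1) * gaussMoment s x + x * gaussMoment (s + 1) x - gaussMoment (s + 2) x := by
    unfold gaussMoment
    rw [integral_sub i01 i2, integral_add (i0.const_mul (s + 1)) (i1.const_mul x),
      integral_const_mul, integral_const_mul]
  rw [e, h0] at h
  linarith

theorem continuousAt_gaussMoment_left {s : ℝ} (hs : -1 < s) (x : ℝ) :
    ContinuousAt (fun r => gaussMoment r x) s := by
  obtain ⟨δ, hδ, hδs⟩ : ∃ δ > 0, -1 < s - δ := ⟨(s + 1) / 2, by linarith, by linarith⟩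
  -- For `r` within `δ` of `s`, `y^r` is at most `y^(s-δ)` on `y ≤ 1` and at most `y^(s+δ)` on `y ≥
  -- 1`.
  refine continuousAt_of_dominated (F := fun r y => gaussWeight r x y)
    (bound := fun y => gaussWeight (s - δ) x y + gaussWeight (s + δ) x y)
    (Eventually.of_forall fun r => (measurable_gaussWeight r x).aestronglyMeasurable) ?_
    ((integrableOn_gaussWeight hδs x).add (integrableOn_gaussWeight (by linarith) x)) ?_
  · filter_upwards [Ioo_mem_nhds (show s - δ < s by linarith) (show s < s + δ by linarith)]
      with r hr
    refine (ae_restrict_iff' measurableSet_Ioi).2 (Eventually.of_forall fun y hy => ?_)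
    have hy : 0 < y := hy
    rw [Real.norm_of_nonneg (gaussWeight_pos r x hy).le]
    have h1 := gaussWeight_pos (s - δ) x hy
    have h2 := gaussWeight_pos (s + δ) x hy
    rcases le_total y 1 with hy1 | hy1
    · have : gaussWeight r x y ≤ gaussWeight (s - δ) x y := mul_le_mul_of_nonneg_right
        (Real.rpow_le_rpow_of_exponent_ge hy hy1 hr.1.le) (Real.exp_pos _).le
      linarith
    · have : gaussWeight r x y ≤ gaussWeight (s + δ) x y := mul_le_mul_of_nonneg_right
        (Real.rpow_le_rpow_of_exponent_le hy1 hr.2.le) (Real.exp_pos _).le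
      linarith
  · refine (ae_restrict_iff' measurableSet_Ioi).2 (Eventually.of_forall fun y hy => ?_)
    exact (Real.continuousAt_const_rpow (ne_of_gt hy)).mul continuousAt_const

/-! ### Monotonicity of moment ratios. -/

/-- Chebyshev's integral inequality: `f` and `g` cross their levels `m` and `k` in opposite
directions, and `m` is the mean of `f` with respect to the weight `w`. -/
theorem integral_mul_mul_le_of_opposite_crossing {α : Type*} [MeasurableSpace α] {μ : Measure α}
    {f g w : α → ℝ} {m k : ℝ} (hcross : ∀ᵐ y ∂μ, (f y - m) * (g y - k) * w y ≤ 0)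
    (hw : Integrable w μ) (hfw : Integrable (fun y => f y * w y) μ)
    (hgw : Integrable (fun y => g y * w y) μ) (hfgw : Integrable (fun y => f y * (g y * w y)) μ)
    (hm : ∫ y, f y * w y ∂μ = m * ∫ y, w y ∂μ) :
    ∫ y, f y * (g y * w y) ∂μ ≤ m * ∫ y, g y * w y ∂μ := by
  have h := integral_nonpos_of_ae hcross
  have e : ∀ y, (f y - m) * (g y - k) * w y
      = (f y * (g y * w y) - m * (g y * w y)) - k * (f y * w y - m * w y) := fun y => by ring
  simp_rw [e] at h
  have i1 : Integrable (fun y => f y * (g y * w y) - m * (g y * w y)) μ :=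
    hfgw.sub (hgw.const_mul m)
  have i2 : Integrable (fun y => f y * w y - m * w y) μ := hfw.sub (hw.const_mul m)
  rw [integral_sub i1 (i2.const_mul k),
    integral_sub hfgw (hgw.const_mul m), integral_const_mul, integral_const_mul,
    integral_sub hfw (hw.const_mul m), integral_const_mul, hm] at h
  linarith

/-- Passing from `x₂` to `x₁` multiplies the weight by the nonincreasing factor `exp(-(x₂ - x₁) y)`,
which cannot raise the mean of `y²`. -/
theorem gaussMoment_add_two_div_mono {s : ℝ} (hs : -1 < s) {x₁ x₂ : ℝ} (hx : x₁ ≤ x₂) :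
    gaussMoment (s + 2) x₁ / gaussMoment s x₁ ≤ gaussMoment (s + 2) x₂ / gaussMoment s x₂ := by
  have p1 := gaussMoment_pos hs x₁
  have p2 := gaussMoment_pos hs x₂
  have p3 := gaussMoment_pos (show -1 < s + 2 by linarith) x₂
  set m := gaussMoment (s + 2) x₂ / gaussMoment s x₂ with hm
  have hm0 : 0 < m := div_pos p3 p2
  set c := √m
  have hc : c ^ 2 = m := Real.sq_sqrt hm0.le
  have hc0 : 0 ≤ c := Real.sqrt_nonneg _
  have ef : ∀ x, ∀ y ∈ Ioi (0 : ℝ), gaussWeight (s + 2) x y = y ^ 2 * gaussWeight s x y := by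
    intro x y hy
    have hy : 0 < y := hy
    rw [gaussWeight, gaussWeight, Real.rpow_add hy, Real.rpow_two]
    ring
  have eg : ∀ y, gaussWeight s x₁ y = Real.exp (-(x₂ - x₁) * y) * gaussWeight s x₂ y := by
    intro y
    rw [gaussWeight, gaussWeight, mul_left_comm, ← Real.exp_add]
    ring_nf
  -- The level `k` is the value of the factor at `c = √m`, where `y²` crosses its mean `m`.
  have h := integral_mul_mul_le_of_opposite_crossing (μ := volume.restrict (Ioi (0 : ℝ)))
    (f := fun y => y ^ 2) (g := fun y => Real.exp (-(x₂ - x₁) * y)) (w := gaussWeight s x₂)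
    (m := m) (k := Real.exp (-(x₂ - x₁) * c)) ?_ (integrableOn_gaussWeight hs x₂) ?_ ?_ ?_ ?_
  · simp_rw [← eg] at h
    rw [← setIntegral_congr_fun measurableSet_Ioi (ef x₁)] at h
    exact (div_le_iff₀ p1).2 h
  · refine (ae_restrict_iff' measurableSet_Ioi).2 (Eventually.of_forall fun y hy => ?_)
    have hy : 0 < y := hy
    refine mul_nonpos_of_nonpos_of_nonneg ?_ (gaussWeight_pos _ _ hy).le
    rw [← hc]
    rcases le_total y c with hyc | hyc
    · refine mul_nonpos_of_nonpos_of_nonneg (by nlinarith) (sub_nonneg.2 (Real.exp_le_exp.2 ?_))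
      nlinarith
    · refine mul_nonpos_of_nonneg_of_nonpos (by nlinarith) (sub_nonpos.2 (Real.exp_le_exp.2 ?_))
      nlinarith
  · exact (integrableOn_gaussWeight (by linarith) x₂).congr_fun (ef x₂) measurableSet_Ioi
  · simp_rw [← eg]
    exact integrableOn_gaussWeight hs x₁
  · simp_rw [← eg]
    exact (integrableOn_gaussWeight (by linarith) x₁).congr_fun (ef x₁) measurableSet_Ioi
  · rw [← setIntegral_congr_fun measurableSet_Ioi (ef x₂)]
    exact (div_mul_cancel₀ _ p2.ne').symm

/-- Here the nonincreasing factor is `y^(-(s₂ - s₁))`, and the mean in question is that of `y`. -/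
theorem gaussMoment_add_one_div_mono {s₁ s₂ : ℝ} (hs : -1 < s₁) (h12 : s₁ ≤ s₂) (x : ℝ) :
    gaussMoment (s₁ + 1) x / gaussMoment s₁ x ≤ gaussMoment (s₂ + 1) x / gaussMoment s₂ x := by
  have hs2 : -1 < s₂ := by linarith
  have p1 := gaussMoment_pos hs x
  have p2 := gaussMoment_pos hs2 x
  have p3 := gaussMoment_pos (show -1 < s₂ + 1 by linarith) x
  set m := gaussMoment (s₂ + 1) x / gaussMoment s₂ x with hm
  have hm0 : 0 < m := div_pos p3 p2
  have ef : ∀ s, ∀ y ∈ Ioi (0 : ℝ), gaussWeight (s + 1) x y = y * gaussWeight s x y := by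
    intro s y hy
    have hy : 0 < y := hy
    rw [gaussWeight, gaussWeight, Real.rpow_add_one hy.ne']
    ring
  have eg : ∀ y ∈ Ioi (0 : ℝ), gaussWeight s₁ x y = y ^ (-(s₂ - s₁)) * gaussWeight s₂ x y := by
    intro y hy
    have hy : 0 < y := hy
    rw [gaussWeight, gaussWeight, ← mul_assoc, ← Real.rpow_add hy]
    ring_nf
  have efg : ∀ y ∈ Ioi (0 : ℝ), gaussWeight (s₁ + 1) x y
      = y * (y ^ (-(s₂ - s₁)) * gaussWeight s₂ x y) := by
    intro y hy
    rw [ef s₁ y hy, eg y hy]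
  have h := integral_mul_mul_le_of_opposite_crossing (μ := volume.restrict (Ioi (0 : ℝ)))
    (f := fun y => y) (g := fun y => y ^ (-(s₂ - s₁))) (w := gaussWeight s₂ x)
    (m := m) (k := m ^ (-(s₂ - s₁))) ?_ (integrableOn_gaussWeight hs2 x) ?_ ?_ ?_ ?_
  · rw [← setIntegral_congr_fun measurableSet_Ioi eg,
      ← setIntegral_congr_fun measurableSet_Ioi efg] at h
    exact (div_le_iff₀ p1).2 h
  · refine (ae_restrict_iff' measurableSet_Ioi).2 (Eventually.of_forall fun y hy => ?_)
    have hy : 0 < y := hy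
    refine mul_nonpos_of_nonpos_of_nonneg ?_ (gaussWeight_pos _ _ hy).le
    rcases le_total y m with hym | hym
    · exact mul_nonpos_of_nonpos_of_nonneg (by linarith)
        (sub_nonneg.2 (Real.rpow_le_rpow_of_nonpos hy hym (by linarith)))
    · exact mul_nonpos_of_nonneg_of_nonpos (by linarith)
        (sub_nonpos.2 (Real.rpow_le_rpow_of_nonpos hm0 hym (by linarith)))
  · exact (integrableOn_gaussWeight (by linarith) x).congr_fun (ef s₂) measurableSet_Ioi
  · exact (integrableOn_gaussWeight hs x).congr_fun eg measurableSet_Ioi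
  · exact (integrableOn_gaussWeight (by linarith) x).congr_fun efg measurableSet_Ioi
  · rw [← setIntegral_congr_fun measurableSet_Ioi (ef s₂)]
    exact (div_mul_cancel₀ _ p2.ne').symm

/-! ### The negative zero of `φ_l''`. -/

theorem phi_eq (l x : ℝ) : phi l x = Real.exp (-x ^ 2 / 2) * gaussMoment (-2 * l) x := by
  rw [phi, gaussMoment, ← integral_const_mul]
  congr 1 with y
  rw [gaussWeight, mul_left_comm, ← Real.exp_add]
  ring_nf

theorem phi''_eq {l : ℝ} (hl : l < 1 / 2) (x : ℝ) :
    phi'' l x = Real.exp (-x ^ 2 / 2) *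
      ((x ^ 2 - 2 * l) * gaussMoment (-2 * l) x - x * gaussMoment (-2 * l + 1) x) := by
  have hs : -1 < -2 * l := by linarith
  have hE : ∀ x : ℝ, HasDerivAt (fun x : ℝ => Real.exp (-x ^ 2 / 2))
      (Real.exp (-x ^ 2 / 2) * -x) x := fun x => by
    refine HasDerivAt.exp ((((hasDerivAt_id x).pow 2).neg.div_const 2).congr_deriv ?_)
    simp
    ring
  have h0 := hasDerivAt_gaussMoment hs
  have h1 := hasDerivAt_gaussMoment (show -1 < -2 * l + 1 by linarith)
  have hd : deriv (phi l) = fun x => Real.exp (-x ^ 2 / 2) *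
      (gaussMoment (-2 * l + 1) x - x * gaussMoment (-2 * l) x) := by
    ext x
    rw [show phi l = fun x => Real.exp (-x ^ 2 / 2) * gaussMoment (-2 * l) x from
      funext (phi_eq l), ((hE x).fun_mul (h0 x)).deriv]
    ring
  rw [phi'', hd, ((hE x).fun_mul ((h1 x).fun_sub ((hasDerivAt_id' x).fun_mul (h0 x)))).deriv]
  have h2 := gaussMoment_add_two hs x
  rw [show -2 * l + 1 + 1 = -2 * l + 2 by ring, h2]
  ring

/-- Up to a positive factor, `phi'' l (-t)`. -/
noncomputable def negCurvature (l t : ℝ) : ℝ :=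
  (t ^ 2 - 2 * l) * gaussMoment (-2 * l) (-t) + t * gaussMoment (-2 * l + 1) (-t)

theorem isNegInflection_iff {l : ℝ} (hl : l < 1 / 2) (x : ℝ) :
    IsNegInflection l x ↔ 0 < -x ∧ negCurvature l (-x) = 0 := by
  rw [IsNegInflection, phi''_eq hl, mul_eq_zero_iff_left (Real.exp_pos _).ne', negCurvature,
    neg_neg, neg_sq, neg_mul x, ← sub_eq_add_neg, neg_pos]

/-- The recurrence trades the first-order moment for a ratio that does not increase with `t`, so the
bracket is visibly increasing on `t ≥ 0`. -/
theorem negCurvature_eq {l : ℝ} (hl : l < 1 / 2) (t : ℝ) :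
    negCurvature l t = gaussMoment (-2 * l) (-t) *
      (t ^ 2 + 1 - 4 * l - gaussMoment (-2 * l + 2) (-t) / gaussMoment (-2 * l) (-t)) := by
  have hs : -1 < -2 * l := by linarith
  have h := gaussMoment_add_two hs (-t)
  rw [mul_sub, mul_div_cancel₀ _ (gaussMoment_pos hs _).ne', h, negCurvature]
  ring

theorem continuous_negCurvature {l : ℝ} (hl : l < 1 / 2) : Continuous (negCurvature l) := by
  have h0 := continuous_gaussMoment (show -1 < -2 * l by linarith)
  have h1 := continuous_gaussMoment (show -1 < -2 * l + 1 by linarith)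
  unfold negCurvature
  fun_prop

/-- The normalised `negCurvature` is strictly increasing. -/
theorem negCurvature_div_lt {l : ℝ} (hl : l < 1 / 2) {t u : ℝ} (ht : 0 ≤ t) (htu : t < u) :
    negCurvature l t / gaussMoment (-2 * l) (-t) <
      negCurvature l u / gaussMoment (-2 * l) (-u) := by
  have hs : -1 < -2 * l := by linarith
  have h := gaussMoment_add_two_div_mono hs (show -u ≤ -t by linarith)
  rw [negCurvature_eq hl, negCurvature_eq hl, mul_div_cancel_left₀ _ (gaussMoment_pos hs _).ne',
    mul_div_cancel_left₀ _ (gaussMoment_pos hs _).ne']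
  nlinarith

theorem negCurvature_neg_of_lt {l : ℝ} (hl : l < 1 / 2) {t u : ℝ} (ht : 0 ≤ t) (htu : t < u)
    (hu : negCurvature l u = 0) : negCurvature l t < 0 := by
  have h := negCurvature_div_lt hl ht htu
  rw [hu, zero_div, div_lt_iff₀ (gaussMoment_pos (by linarith) _), zero_mul] at h
  exact h

theorem negCurvature_pos_of_lt {l : ℝ} (hl : l < 1 / 2) {t u : ℝ} (ht : 0 ≤ t) (htu : t < u)
    (hz : negCurvature l t = 0) : 0 < negCurvature l u := by
  have h := negCurvature_div_lt hl ht htu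
  rw [hz, zero_div, lt_div_iff₀ (gaussMoment_pos (by linarith) _), zero_mul] at h
  exact h

theorem exists_negCurvature_eq_zero {l : ℝ} (hl : l ∈ Ioo (0 : ℝ) (1 / 2)) :
    ∃ t, 0 < t ∧ negCurvature l t = 0 := by
  have p0 := gaussMoment_pos (show -1 < -2 * l by linarith [hl.2])
  have p1 := gaussMoment_pos (show -1 < -2 * l + 1 by linarith [hl.2]) (-1)
  have h0 : negCurvature l 0 < 0 := by
    simp only [negCurvature]
    nlinarith [mul_pos hl.1 (p0 (-0))]
  have h1 : 0 < negCurvature l 1 := by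
    simp only [negCurvature]
    nlinarith [mul_pos (sub_pos.2 hl.2) (p0 (-1))]
  obtain ⟨t, ht, htz⟩ := intermediate_value_Ioo zero_le_one
    (continuous_negCurvature hl.2).continuousOn ⟨h0, h1⟩
  exact ⟨t, ht.1, htz⟩

theorem existsUnique_isNegInflection {l : ℝ} (hl : l ∈ Ioo (0 : ℝ) (1 / 2)) :
    ∃! x : ℝ, IsNegInflection l x := by
  obtain ⟨t, ht, htz⟩ := exists_negCurvature_eq_zero hl
  refine ⟨-t, (isNegInflection_iff hl.2 _).2 (by simpa using ⟨ht, htz⟩), fun x hx => ?_⟩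
  obtain ⟨hx, hxz⟩ := (isNegInflection_iff hl.2 _).1 hx
  rcases lt_trichotomy (-x) t with h | h | h
  · exact absurd hxz (negCurvature_neg_of_lt hl.2 hx.le h htz).ne
  · linarith
  · exact absurd hxz (negCurvature_pos_of_lt hl.2 ht.le h htz).ne'

theorem neg_xOne_spec {l : ℝ} (hl : l ∈ Ioo (0 : ℝ) (1 / 2)) :
    0 < -xOne l ∧ negCurvature l (-xOne l) = 0 :=
  (isNegInflection_iff hl.2 _).1 (Classical.epsilon_spec (existsUnique_isNegInflection hl).exists)

theorem xOne_sq_lt {l : ℝ} (hl : l ∈ Ioo (0 : ℝ) (1 / 2)) : (-xOne l) ^ 2 < 2 * l := by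
  obtain ⟨h0, hz⟩ := neg_xOne_spec hl
  have p0 := gaussMoment_pos (show -1 < -2 * l by linarith [hl.2]) (-(-xOne l))
  have p1 := gaussMoment_pos (show -1 < -2 * l + 1 by linarith [hl.2]) (-(-xOne l))
  rw [negCurvature] at hz
  by_contra! h
  nlinarith [mul_nonneg (sub_nonneg.2 h) p0.le, mul_pos h0 p1]

/-- At the root the bracket of `negCurvature_eq` vanishes, and the moment ratio in it is positive.
This bound forces the root to `-1` as `l → 1/2`. -/
theorem lt_xOne_sq {l : ℝ} (hl : l ∈ Ioo (0 : ℝ) (1 / 2)) : 4 * l - 1 < (-xOne l) ^ 2 := by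
  obtain ⟨h0, hz⟩ := neg_xOne_spec hl
  have p0 := gaussMoment_pos (show -1 < -2 * l by linarith [hl.2]) (-(-xOne l))
  have p2 := gaussMoment_pos (show -1 < -2 * l + 2 by linarith [hl.2]) (-(-xOne l))
  rw [negCurvature_eq hl.2, mul_eq_zero_iff_left p0.ne'] at hz
  linarith [div_pos p2 p0]

/-- For fixed `t > 0` the normalised curvature `t² - 2l + t M_{1-2l}(-t)/M_{-2l}(-t)` strictly
decreases in `l`, which pushes its root to the right. -/
theorem neg_xOne_lt {l₁ l₂ : ℝ} (h₁ : l₁ ∈ Ioo (0 : ℝ) (1 / 2)) (h₂ : l₂ ∈ Ioo (0 : ℝ) (1 / 2))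
    (h : l₁ < l₂) : -xOne l₁ < -xOne l₂ := by
  obtain ⟨p1, z1⟩ := neg_xOne_spec h₁
  obtain ⟨p2, z2⟩ := neg_xOne_spec h₂
  by_contra! hle
  have hs1 : -1 < -2 * l₁ := by linarith [h₁.2]
  have hs2 : -1 < -2 * l₂ := by linarith [h₂.2]
  have hneg : negCurvature l₂ (-xOne l₁) ≥ 0 := by
    rcases hle.eq_or_lt with e | e
    · rw [← e, z2]
    · exact (negCurvature_pos_of_lt h₂.2 p2.le e z2).le
  set t := -xOne l₁
  have q1 := gaussMoment_pos hs1 (-t)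
  have q2 := gaussMoment_pos hs2 (-t)
  have hm := gaussMoment_add_one_div_mono hs2 (show -2 * l₂ ≤ -2 * l₁ by linarith) (-t)
  have e : ∀ l, 0 < gaussMoment (-2 * l) (-t) → negCurvature l t = gaussMoment (-2 * l) (-t) *
      (t ^ 2 - 2 * l + t * (gaussMoment (-2 * l + 1) (-t) / gaussMoment (-2 * l) (-t))) := by
    intro l hl
    rw [negCurvature, mul_add, mul_left_comm _ t, mul_div_cancel₀ _ hl.ne', mul_comm (t ^ 2 - _)]
  rw [e l₁ q1, mul_eq_zero_iff_left q1.ne'] at z1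
  rw [e l₂ q2] at hneg
  have := nonneg_of_mul_nonneg_right hneg q2
  nlinarith [mul_le_mul_of_nonneg_left hm p1.le]

/-! ### Continuous dependence of the roots on `l`. -/

/-- A root `r` of `F a` where the sign changes depends continuously on the parameter `a`. -/
theorem continuousOn_of_sign_change {F : ℝ → ℝ → ℝ} {r : ℝ → ℝ} {S : Set ℝ}
    (hF : ∀ t, ∀ a ∈ S, ContinuousAt (fun b => F b t) a) (hr : ∀ a ∈ S, 0 < r a)
    (hneg : ∀ a ∈ S, ∀ t, 0 ≤ t → t < r a → F a t < 0)
    (hpos : ∀ a ∈ S, ∀ t, r a < t → 0 < F a t) : ContinuousOn r S := by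
  intro a ha
  refine tendsto_order.2 ⟨fun b hb => ?_, fun b hb => ?_⟩
  · obtain ⟨t, hbt, hta⟩ := exists_between (max_lt hb (hr a ha))
    rw [max_lt_iff] at hbt
    have hev := (hF t a ha).continuousWithinAt (s := S) |>.eventually_lt_const
      (hneg a ha t hbt.2.le hta)
    filter_upwards [hev, self_mem_nhdsWithin] with c hc hcS
    by_contra! h
    exact lt_asymm hc (hpos c hcS t (h.trans_lt hbt.1))
  · obtain ⟨t, hat, htb⟩ := exists_between hb
    have hev := (hF t a ha).continuousWithinAt (s := S) |>.eventually_const_lt (hpos a ha t hat)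
    filter_upwards [hev, self_mem_nhdsWithin] with c hc hcS
    by_contra! h
    exact lt_asymm hc (hneg c hcS t ((hr a ha).trans hat).le (htb.trans_le h))

theorem continuousAt_gaussMoment_neg_two_mul {l : ℝ} (hl : l < 1 / 2) (x : ℝ) :
    ContinuousAt (fun l => gaussMoment (-2 * l) x) l :=
  (continuousAt_gaussMoment_left (show -1 < -2 * l by linarith) x).comp
    (f := fun l : ℝ => -2 * l) (by fun_prop)

theorem continuousAt_gaussMoment_neg_two_mul_add_one {l : ℝ} (hl : l < 1 / 2) (x : ℝ) :
    ContinuousAt (fun l => gaussMoment (-2 * l + 1) x) l :=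
  (continuousAt_gaussMoment_left (show -1 < -2 * l + 1 by linarith) x).comp
    (f := fun l : ℝ => -2 * l + 1) (by fun_prop)

theorem continuousOn_neg_xOne : ContinuousOn (fun l => -xOne l) (Ioo (0 : ℝ) (1 / 2)) := by
  refine continuousOn_of_sign_change (F := negCurvature) (fun t l hl => ?_)
    (fun l hl => (neg_xOne_spec hl).1)
    (fun l hl t h0 ht => negCurvature_neg_of_lt hl.2 h0 ht (neg_xOne_spec hl).2)
    (fun l hl t ht => negCurvature_pos_of_lt hl.2 (neg_xOne_spec hl).1.le ht (neg_xOne_spec hl).2)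
  have h0 := continuousAt_gaussMoment_neg_two_mul hl.2 (-t)
  have h1 := continuousAt_gaussMoment_neg_two_mul_add_one hl.2 (-t)
  unfold negCurvature
  fun_prop

/-! ### The positive zero for the even part. -/

/-- The even part `phi l x + phi l (-x)`, freed of its Gaussian factor. -/
noncomputable def evenMoment (l x : ℝ) : ℝ := gaussMoment (-2 * l) x + gaussMoment (-2 * l) (-x)

/-- The derivative of `evenMoment`. -/
noncomputable def oddMoment (l x : ℝ) : ℝ :=
  gaussMoment (-2 * l + 1) x - gaussMoment (-2 * l + 1) (-x)

/-- The combination `A' - x A` for `A = evenMoment l`. -/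
noncomputable def evenSlope (l x : ℝ) : ℝ := oddMoment l x - x * evenMoment l x

/-- Up to a negative factor, the second derivative of the even part of `phi l`; it solves the
Hermite equation `v'' - x v' + (1 + 2 l) v = 0`. -/
noncomputable def evenCurvature (l x : ℝ) : ℝ := 2 * l * evenMoment l x + x * evenSlope l x

theorem isEvenInflection_iff {l : ℝ} (hl : l < 1 / 2) (z : ℝ) :
    IsEvenInflection l z ↔ 0 < z ∧ evenCurvature l z = 0 := by
  have e : phi'' l z + phi'' l (-z) = -Real.exp (-z ^ 2 / 2) * evenCurvature l z := by
    rw [phi''_eq hl, phi''_eq hl, evenCurvature, evenSlope, evenMoment, oddMoment, neg_sq]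
    ring
  rw [IsEvenInflection, e, mul_eq_zero_iff_left (neg_ne_zero.2 (Real.exp_pos _).ne')]

theorem evenMoment_pos {l : ℝ} (hl : l < 1 / 2) (x : ℝ) : 0 < evenMoment l x :=
  add_pos (gaussMoment_pos (by linarith) x) (gaussMoment_pos (by linarith) (-x))

theorem oddMoment_pos {l : ℝ} (hl : l < 1 / 2) {x : ℝ} (hx : 0 < x) : 0 < oddMoment l x :=
  sub_pos.2 (strictMono_gaussMoment (by linarith) (by linarith))

theorem hasDerivAt_gaussMoment_neg {s : ℝ} (hs : -1 < s) (x : ℝ) :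
    HasDerivAt (fun x => gaussMoment s (-x)) (-gaussMoment (s + 1) (-x)) x :=
  ((hasDerivAt_gaussMoment hs (-x)).comp x (hasDerivAt_neg x)).congr_deriv (by ring)

theorem hasDerivAt_evenMoment {l : ℝ} (hl : l < 1 / 2) (x : ℝ) :
    HasDerivAt (evenMoment l) (oddMoment l x) x := by
  have hs : -1 < -2 * l := by linarith
  exact (hasDerivAt_gaussMoment hs x).add (hasDerivAt_gaussMoment_neg hs x)

/-- By the recurrence `A = evenMoment l` satisfies `A'' = x A' + (1 - 2l) A`, so all but one term of
`A'' - A - x A'` cancels. -/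
theorem hasDerivAt_evenSlope {l : ℝ} (hl : l < 1 / 2) (x : ℝ) :
    HasDerivAt (evenSlope l) (-(2 * l) * evenMoment l x) x := by
  have hs : -1 < -2 * l + 1 := by linarith
  refine (((hasDerivAt_gaussMoment hs x).sub (hasDerivAt_gaussMoment_neg hs x)).sub
    ((hasDerivAt_id' x).mul (hasDerivAt_evenMoment hl x))).congr_deriv ?_
  have h := gaussMoment_add_two (show -1 < -2 * l by linarith)
  rw [show -2 * l + 1 + 1 = -2 * l + 2 by ring, h, h, evenMoment, oddMoment]
  ring

theorem hasDerivAt_evenCurvature {l : ℝ} (hl : l < 1 / 2) (x : ℝ) :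
    HasDerivAt (evenCurvature l) ((1 + 2 * l) * evenSlope l x) x := by
  refine (((hasDerivAt_evenMoment hl x).const_mul (2 * l)).add
    ((hasDerivAt_id' x).mul (hasDerivAt_evenSlope hl x))).congr_deriv ?_
  rw [evenSlope]
  ring

theorem antitoneOn_Ici_of_hasDerivAt_nonpos {f f' : ℝ → ℝ} (hf : ∀ x, HasDerivAt f (f' x) x)
    (h : ∀ x, 0 < x → f' x ≤ 0) : AntitoneOn f (Ici 0) := by
  refine antitoneOn_of_deriv_nonpos (convex_Ici 0)
    (fun x _ => (hf x).continuousAt.continuousWithinAt)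
    (fun x _ => (hf x).differentiableAt.differentiableWithinAt) fun x hx => ?_
  rw [interior_Ici] at hx
  rw [(hf x).deriv]
  exact h x hx

theorem evenMoment_zero_le {l : ℝ} (hl : l < 1 / 2) {x : ℝ} (hx : 0 ≤ x) :
    evenMoment l 0 ≤ evenMoment l x := by
  have h := antitoneOn_Ici_of_hasDerivAt_nonpos (fun x => (hasDerivAt_evenMoment hl x).neg)
    (fun x hx => (neg_neg_of_pos (oddMoment_pos hl hx)).le) self_mem_Ici hx hx
  exact neg_le_neg_iff.1 h

theorem evenSlope_zero (l : ℝ) : evenSlope l 0 = 0 := by simp [evenSlope, oddMoment]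

/-- Integrate the derivative `-2l A ≤ -2l A(0)` from `0`. -/
theorem evenSlope_le {l : ℝ} (hl : l ∈ Ioo (0 : ℝ) (1 / 2)) {x : ℝ} (hx : 0 ≤ x) :
    evenSlope l x ≤ -(2 * l * evenMoment l 0) * x := by
  have h := antitoneOn_Ici_of_hasDerivAt_nonpos
    (fun x => (hasDerivAt_evenSlope hl.2 x).add ((hasDerivAt_id' x).const_mul
      (2 * l * evenMoment l 0)))
    (fun x hx => by nlinarith [mul_le_mul_of_nonneg_left (evenMoment_zero_le hl.2 hx.le) hl.1.le])
    self_mem_Ici hx hx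
  simp only [Pi.add_apply, evenSlope_zero] at h
  linarith

theorem evenSlope_neg {l : ℝ} (hl : l ∈ Ioo (0 : ℝ) (1 / 2)) {x : ℝ} (hx : 0 < x) :
    evenSlope l x < 0 := by
  have h := evenSlope_le hl hx.le
  nlinarith [mul_pos (mul_pos hl.1 (evenMoment_pos hl.2 0)) hx]

theorem evenCurvature_strictAntiOn {l : ℝ} (hl : l ∈ Ioo (0 : ℝ) (1 / 2)) :
    StrictAntiOn (evenCurvature l) (Ici 0) := by
  refine strictAntiOn_of_deriv_neg (convex_Ici 0)
    (fun x _ => (hasDerivAt_evenCurvature hl.2 x).continuousAt.continuousWithinAt) fun x hx => ?_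
  rw [interior_Ici] at hx
  rw [(hasDerivAt_evenCurvature hl.2 x).deriv]
  exact mul_neg_of_pos_of_neg (by linarith [hl.1]) (evenSlope_neg hl hx)

theorem evenCurvature_zero (l : ℝ) : evenCurvature l 0 = 2 * l * evenMoment l 0 := by
  simp [evenCurvature]

/-- A second integration, of `v' = (1 + 2l) evenSlope`, from `v(0) = 2l A(0)`. The quadratic bound
yields both the existence of the zero and `zConst_sq_le`. -/
theorem evenCurvature_le {l : ℝ} (hl : l ∈ Ioo (0 : ℝ) (1 / 2)) {x : ℝ} (hx : 0 ≤ x) :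
    evenCurvature l x ≤ 2 * l * evenMoment l 0 * (1 - (1 + 2 * l) * x ^ 2 / 2) := by
  have h := antitoneOn_Ici_of_hasDerivAt_nonpos
    (fun x => (hasDerivAt_evenCurvature hl.2 x).add (((hasDerivAt_id' x).pow 2).const_mul
      (l * evenMoment l 0 * (1 + 2 * l))))
    (fun x hx => by
      have h1 := mul_le_mul_of_nonneg_left (evenSlope_le hl hx.le)
        (show 0 ≤ 1 + 2 * l by linarith [hl.1])
      simp only [Nat.cast_ofNat, Nat.add_one_sub_one, pow_one]
      linarith)
    self_mem_Ici hx hx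
  simp only [Pi.add_apply, Pi.pow_apply, evenCurvature_zero] at h
  linarith

theorem exists_evenCurvature_eq_zero {l : ℝ} (hl : l ∈ Ioo (0 : ℝ) (1 / 2)) :
    ∃ z, 0 < z ∧ evenCurvature l z = 0 := by
  have p : 0 < l * evenMoment l 0 := mul_pos hl.1 (evenMoment_pos hl.2 0)
  have h0 : 0 < evenCurvature l 0 := by
    rw [evenCurvature_zero]
    linarith
  have h2 : evenCurvature l 2 < 0 := by
    nlinarith [evenCurvature_le hl (zero_le_two (α := ℝ)), mul_pos hl.1 p]
  obtain ⟨z, hz, hzz⟩ := intermediate_value_Ioo' zero_le_two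
    (fun x _ => (hasDerivAt_evenCurvature hl.2 x).continuousAt.continuousWithinAt) ⟨h2, h0⟩
  exact ⟨z, hz.1, hzz⟩

theorem existsUnique_isEvenInflection {l : ℝ} (hl : l ∈ Ioo (0 : ℝ) (1 / 2)) :
    ∃! z : ℝ, IsEvenInflection l z := by
  obtain ⟨z, hz, hzz⟩ := exists_evenCurvature_eq_zero hl
  refine ⟨z, (isEvenInflection_iff hl.2 _).2 ⟨hz, hzz⟩, fun y hy => ?_⟩
  obtain ⟨hy, hyz⟩ := (isEvenInflection_iff hl.2 _).1 hy
  exact (evenCurvature_strictAntiOn hl).injOn hy.le hz.le (hyz.trans hzz.symm)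

theorem zConst_spec {l : ℝ} (hl : l ∈ Ioo (0 : ℝ) (1 / 2)) :
    0 < zConst l ∧ evenCurvature l (zConst l) = 0 :=
  (isEvenInflection_iff hl.2 _).1 (Classical.epsilon_spec (existsUnique_isEvenInflection hl).exists)

theorem evenCurvature_pos_of_lt {l : ℝ} (hl : l ∈ Ioo (0 : ℝ) (1 / 2)) {x : ℝ} (hx : 0 ≤ x)
    (h : x < zConst l) : 0 < evenCurvature l x :=
  (zConst_spec hl).2 ▸ evenCurvature_strictAntiOn hl hx (zConst_spec hl).1.le h

theorem zConst_sq_le {l : ℝ} (hl : l ∈ Ioo (0 : ℝ) (1 / 2)) : (1 + 2 * l) * zConst l ^ 2 ≤ 2 := by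
  obtain ⟨h0, hz⟩ := zConst_spec hl
  have h := evenCurvature_le hl h0.le
  rw [hz] at h
  have := nonneg_of_mul_nonneg_right h (mul_pos (by linarith [hl.1]) (evenMoment_pos hl.2 0))
  linarith

theorem lt_zConst_sq {l : ℝ} (hl : l ∈ Ioo (0 : ℝ) (1 / 2)) : 2 * l < zConst l ^ 2 := by
  obtain ⟨h0, hz⟩ := zConst_spec hl
  have p0 := evenMoment_pos hl.2 (zConst l)
  have p1 := oddMoment_pos hl.2 h0
  rw [evenCurvature, evenSlope] at hz
  by_contra! h
  nlinarith [mul_nonneg (sub_nonneg.2 h) p0.le, mul_pos h0 p1]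

/-- Sturm comparison: the solution with the larger coefficient `1 + 2l` must vanish no later. -/
theorem zConst_le {l₁ l₂ : ℝ} (h₁ : l₁ ∈ Ioo (0 : ℝ) (1 / 2)) (h₂ : l₂ ∈ Ioo (0 : ℝ) (1 / 2))
    (h : l₁ < l₂) : zConst l₂ ≤ zConst l₁ := by
  by_contra! hlt
  obtain ⟨p1, z1⟩ := zConst_spec h₁
  have hE : ∀ x : ℝ, HasDerivAt (fun x : ℝ => Real.exp (-x ^ 2 / 2))
      (Real.exp (-x ^ 2 / 2) * -x) x := fun x => by
    refine HasDerivAt.exp ((((hasDerivAt_id x).pow 2).neg.div_const 2).congr_deriv ?_)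
    simp
    ring
  -- This is the Wronskian `v₁' v₂ - v₂' v₁` with the integrating factor of the Hermite equation. It
  -- is `0` at `0` and nondecreasing while both `v` are positive, yet would be negative at the first
  -- zero of `v₁`.
  have hW : ∀ x, HasDerivAt (fun x => Real.exp (-x ^ 2 / 2) *
      ((1 + 2 * l₁) * evenSlope l₁ x * evenCurvature l₂ x
        - (1 + 2 * l₂) * evenSlope l₂ x * evenCurvature l₁ x))
      (Real.exp (-x ^ 2 / 2) * (2 * (l₂ - l₁) * (evenCurvature l₁ x * evenCurvature l₂ x))) x :=
    fun x => by
      have b1 := (hasDerivAt_evenSlope h₁.2 x).const_mul (1 + 2 * l₁)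
      have b2 := (hasDerivAt_evenSlope h₂.2 x).const_mul (1 + 2 * l₂)
      refine ((hE x).mul ((b1.mul (hasDerivAt_evenCurvature h₂.2 x)).sub
        (b2.mul (hasDerivAt_evenCurvature h₁.2 x)))).congr_deriv ?_
      simp only [Pi.mul_apply, Pi.sub_apply, evenCurvature]
      ring
  have hmono := monotoneOn_of_deriv_nonneg (convex_Icc 0 (zConst l₁))
    (fun x _ => (hW x).continuousAt.continuousWithinAt)
    (fun x _ => (hW x).differentiableAt.differentiableWithinAt) (fun x hx => by
      rw [interior_Icc] at hx
      rw [(hW x).deriv]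
      have v1 := evenCurvature_pos_of_lt h₁ hx.1.le hx.2
      have v2 := evenCurvature_pos_of_lt h₂ hx.1.le (hx.2.trans hlt)
      have := sub_pos.2 h
      positivity) (left_mem_Icc.2 p1.le) (right_mem_Icc.2 p1.le) p1.le
  simp only [evenSlope_zero, z1, mul_zero, zero_mul, sub_zero] at hmono
  have v2 := evenCurvature_pos_of_lt h₂ p1.le hlt
  have hn : (1 + 2 * l₁) * evenSlope l₁ (zConst l₁) * evenCurvature l₂ (zConst l₁) < 0 :=
    mul_neg_of_neg_of_pos (mul_neg_of_pos_of_neg (by linarith [h₁.1]) (evenSlope_neg h₁ p1)) v2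
  exact absurd hmono (not_le.2 (mul_neg_of_pos_of_neg (Real.exp_pos _) hn))

theorem continuousOn_zConst : ContinuousOn zConst (Ioo (0 : ℝ) (1 / 2)) := by
  refine continuousOn_of_sign_change (F := fun l x => -evenCurvature l x) (fun t l hl => ?_)
    (fun l hl => (zConst_spec hl).1)
    (fun l hl t h0 ht => neg_neg_of_pos (evenCurvature_pos_of_lt hl h0 ht))
    (fun l hl t ht => neg_pos.2 ?_)
  · have h0 := continuousAt_gaussMoment_neg_two_mul hl.2
    have h1 := continuousAt_gaussMoment_neg_two_mul_add_one hl.2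
    have := h0 t
    have := h0 (-t)
    have := h1 t
    have := h1 (-t)
    unfold evenCurvature evenSlope evenMoment oddMoment
    fun_prop
  · have h0 := (zConst_spec hl).1
    exact (zConst_spec hl).2 ▸ evenCurvature_strictAntiOn hl h0.le (h0.trans ht).le ht

/-! ### The ratio `σ_l`: monotonicity, range and limits. -/

theorem continuousOn_sigmaOf : ContinuousOn sigmaOf (Ioo (0 : ℝ) (1 / 2)) :=
  continuousOn_neg_xOne.div continuousOn_zConst fun _ hl => (zConst_spec hl).1.ne'

theorem strictMonoOn_sigmaOf : StrictMonoOn sigmaOf (Ioo (0 : ℝ) (1 / 2)) :=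
  fun _ h₁ _ h₂ h => div_lt_div₀ (neg_xOne_lt h₁ h₂ h) (zConst_le h₁ h₂ h)
    (neg_xOne_spec h₂).1.le (zConst_spec h₂).1

theorem sigmaOf_mem_Ioo {l : ℝ} (hl : l ∈ Ioo (0 : ℝ) (1 / 2)) : sigmaOf l ∈ Ioo (0 : ℝ) 1 := by
  have hz := (zConst_spec hl).1
  refine ⟨div_pos (neg_xOne_spec hl).1 hz, (div_lt_one hz).2 ?_⟩
  exact lt_of_pow_lt_pow_left₀ 2 hz.le ((xOne_sq_lt hl).trans (lt_zConst_sq hl))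

theorem exists_sigmaOf_lt {s : ℝ} (hs : 0 < s) : ∃ l ∈ Ioo (0 : ℝ) (1 / 2), sigmaOf l < s := by
  -- `1/4` is an arbitrary reference parameter: for smaller `l`, `z^l` stays at least `z^(1/4)`,
  -- while `x₁² < 2l` tends to `0`.
  have hq : (1 / 4 : ℝ) ∈ Ioo (0 : ℝ) (1 / 2) := by constructor <;> norm_num
  have hz := (zConst_spec hq).1
  set c := s * zConst (1 / 4) with hc
  have hc0 : 0 < c := mul_pos hs hz
  set l := min (1 / 8) (c ^ 2 / 2) with hl
  have hl1 : l ≤ 1 / 8 := min_le_left _ _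
  have hl2 : l ≤ c ^ 2 / 2 := min_le_right _ _
  have hl0 : 0 < l := lt_min (by norm_num) (by positivity)
  have hm : l ∈ Ioo (0 : ℝ) (1 / 2) := ⟨hl0, by linarith⟩
  refine ⟨l, hm, (div_lt_iff₀ (zConst_spec hm).1).2 ?_⟩
  have h1 : -xOne l < c := lt_of_pow_lt_pow_left₀ 2 hc0.le (by linarith [xOne_sq_lt hm])
  have h2 := mul_le_mul_of_nonneg_left (zConst_le hm hq (by linarith)) hs.le
  linarith

theorem exists_lt_sigmaOf {s : ℝ} (hs : s ∈ Ioo (0 : ℝ) 1) :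
    ∃ l ∈ Ioo (0 : ℝ) (1 / 2), s < sigmaOf l := by
  have hs2 : s ^ 2 < 1 := by nlinarith [hs.1, hs.2]
  -- With this choice `4l - 1 = (1 + s²)/2` and `1 + 2l = (7 + s²)/4`, so the inequality `h4`
  -- amounts to `(1 - s²)(7 - s²) > 0`.
  set l := (3 + s ^ 2) / 8 with hl
  have hm : l ∈ Ioo (0 : ℝ) (1 / 2) := ⟨by positivity, by linarith⟩
  refine ⟨l, hm, (lt_div_iff₀ (zConst_spec hm).1).2 ?_⟩
  refine lt_of_pow_lt_pow_left₀ 2 (neg_xOne_spec hm).1.le ?_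
  have h1 := lt_xOne_sq hm
  have h2 := zConst_sq_le hm
  have h3 : s ^ 2 * ((1 + 2 * l) * zConst l ^ 2) ≤ s ^ 2 * 2 :=
    mul_le_mul_of_nonneg_left h2 (sq_nonneg s)
  have h4 : s ^ 2 * 2 < (4 * l - 1) * (1 + 2 * l) := by
    rw [hl]
    nlinarith [sq_nonneg s]
  have h5 : (1 + 2 * l) * (s * zConst l) ^ 2 < (1 + 2 * l) * (-xOne l) ^ 2 := by
    nlinarith [hm.1]
  exact lt_of_mul_lt_mul_left h5 (by linarith [hm.1])

theorem existsUnique_isLambda {s : ℝ} (hs : s ∈ Ioo (0 : ℝ) 1) : ∃! l : ℝ, IsLambda s l := by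
  obtain ⟨l₁, h₁, hs₁⟩ := exists_sigmaOf_lt hs.1
  obtain ⟨l₂, h₂, hs₂⟩ := exists_lt_sigmaOf hs
  obtain ⟨l, hl, hls⟩ := isPreconnected_Ioo.intermediate_value h₁ h₂ continuousOn_sigmaOf
    ⟨hs₁.le, hs₂.le⟩
  exact ⟨l, ⟨hl, hls⟩, fun k hk => strictMonoOn_sigmaOf.injOn hk.1 hl (hk.2.trans hls.symm)⟩

/-! ### The inverse function `λ_s`. -/

theorem lambdaOf_spec {s : ℝ} (hs : s ∈ Ioo (0 : ℝ) 1) : IsLambda s (lambdaOf s) :=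
  Classical.epsilon_spec (existsUnique_isLambda hs).exists

theorem lambdaOf_lt_iff {s l : ℝ} (hs : s ∈ Ioo (0 : ℝ) 1) (hl : l ∈ Ioo (0 : ℝ) (1 / 2)) :
    lambdaOf s < l ↔ s < sigmaOf l := by
  obtain ⟨hm, he⟩ := lambdaOf_spec hs
  rw [← strictMonoOn_sigmaOf.lt_iff_lt hm hl, he]

theorem lt_lambdaOf_iff {s l : ℝ} (hs : s ∈ Ioo (0 : ℝ) 1) (hl : l ∈ Ioo (0 : ℝ) (1 / 2)) :
    l < lambdaOf s ↔ sigmaOf l < s := by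
  obtain ⟨hm, he⟩ := lambdaOf_spec hs
  rw [← strictMonoOn_sigmaOf.lt_iff_lt hl hm, he]

theorem tendsto_lambdaOf_zero : Tendsto lambdaOf (𝓝[>] (0 : ℝ)) (𝓝 0) := by
  have h01 : ∀ᶠ s in 𝓝[>] (0 : ℝ), s ∈ Ioo (0 : ℝ) 1 := Ioo_mem_nhdsGT one_pos
  refine tendsto_order.2 ⟨fun b hb => ?_, fun b hb => ?_⟩
  · filter_upwards [h01] with s hs using hb.trans (lambdaOf_spec hs).1.1
  · obtain ⟨l, hl0, hlb⟩ := exists_between (lt_min hb (show (0 : ℝ) < 1 / 2 by norm_num))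
    rw [lt_min_iff] at hlb
    have hl : l ∈ Ioo (0 : ℝ) (1 / 2) := ⟨hl0, hlb.2⟩
    filter_upwards [h01, Ioo_mem_nhdsGT (sigmaOf_mem_Ioo hl).1] with s hs hsl
    exact ((lambdaOf_lt_iff hs hl).2 hsl.2).trans hlb.1

theorem tendsto_lambdaOf_one : Tendsto lambdaOf (𝓝[<] (1 : ℝ)) (𝓝 (1 / 2)) := by
  have h01 : ∀ᶠ s in 𝓝[<] (1 : ℝ), s ∈ Ioo (0 : ℝ) 1 := Ioo_mem_nhdsLT one_pos
  refine tendsto_order.2 ⟨fun b hb => ?_, fun b hb => ?_⟩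
  · obtain ⟨l, hlb, hl1⟩ := exists_between (max_lt hb (show (0 : ℝ) < 1 / 2 by norm_num))
    rw [max_lt_iff] at hlb
    have hl : l ∈ Ioo (0 : ℝ) (1 / 2) := ⟨hlb.2, hl1⟩
    filter_upwards [h01, Ioo_mem_nhdsLT (sigmaOf_mem_Ioo hl).2] with s hs hsl
    exact hlb.1.trans ((lt_lambdaOf_iff hs hl).2 hsl.1)
  · filter_upwards [h01] with s hs using (lambdaOf_spec hs).1.2.trans hb

/-- The first three clauses say that the constants `x₁^l`, `z^l` and `λ_s` are well defined. -/
theorem corollary2309 :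
    (∀ l ∈ Ioo (0 : ℝ) (1 / 2), ∃! x : ℝ, IsNegInflection l x) ∧
    (∀ l ∈ Ioo (0 : ℝ) (1 / 2), ∃! z : ℝ, IsEvenInflection l z) ∧
    (∀ s ∈ Ioo (0 : ℝ) 1, ∃! l : ℝ, IsLambda s l) ∧
    StrictMonoOn lambdaOf (Ioo (0 : ℝ) 1) ∧
    Tendsto lambdaOf (𝓝[>] (0 : ℝ)) (𝓝 0) ∧
    Tendsto lambdaOf (𝓝[<] (1 : ℝ)) (𝓝 (1 / 2)) := by
  refine ⟨fun l hl => existsUnique_isNegInflection hl, fun l hl => existsUnique_isEvenInflection hl,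
    fun s hs => existsUnique_isLambda hs, fun s hs t ht hst => ?_, tendsto_lambdaOf_zero,
    tendsto_lambdaOf_one⟩
  rw [lambdaOf_lt_iff hs (lambdaOf_spec ht).1, (lambdaOf_spec ht).2]
  exact hst
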